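/- A finite family $u_1,\dots,u_m$ of unit vectors in Euclidean space $\mathbb R^n$ is called selectively balancing if there are coefficients $\varepsilon_1,\dots,\varepsilon_m\in\{-1,0,1\}$, not all zero, such that $\bigl\|\sum_{i=1}^m \varepsilon_i u_i\bigr\|<1$, where $\|\cdot\|$ is the Euclidean norm. For $n\ge 0$ let $\sigma(n)$ be the least integer $m\ge 0$ such that any $m$ unit vectors in $\mathbb R^n$ are selectively balancing. Theorem. The number $\sigma(n)$ exists for every $n$, and $$\sigma(n)\sim \tfrac12\, n\log_2 n\qquad (n\to\infty).$$ In other words, for any two real constants $c_1>1/2>c_2$ there is $n_0$ such that $c_1\, n\log_2 n>\sigma(n)>c_2\, n\log_2 n$ for all $n\ge n_0$. -/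

import Mathlib

open Filter Asymptotics

/-- A finite family `u` of vectors is selectively balancing if some combination of it with
coefficients in `{-1, 0, 1}`, not all zero, has Euclidean norm `< 1`. -/
def SelectivelyBalancing {n m : ℕ} (u : Fin m → EuclideanSpace ℝ (Fin n)) : Prop :=
  ∃ ε : Fin m → ℤ, (∀ i, ε i ∈ ({-1, 0, 1} : Set ℤ)) ∧ (∃ i, ε i ≠ 0) ∧
    ‖∑ i, (ε i : ℝ) • u i‖ < 1

/-- The numbers `m` such that any `m` unit vectors in `ℝⁿ` are selectively balancing.
(A family with a repeated vector is always selectively balancing, so that it makes no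
difference whether the vectors are required to be distinct.) -/
def balancingNumbers (n : ℕ) : Set ℕ :=
  {m | ∀ u : Fin m → EuclideanSpace ℝ (Fin n), (∀ i, ‖u i‖ = 1) → SelectivelyBalancing u}

/-- The minimum `m` such that any `m` unit vectors in `ℝⁿ` are selectively balancing. -/
noncomputable def sigmaBal (n : ℕ) : ℕ := sInf (balancingNumbers n)

/-!
The upper bound is a packing argument. If `u` is not selectively balancing, the `2 ^ m` points
`∑ i ∈ A, u i`, for `A` a subset of the index set, are at mutual distance at least `1`. Their mean
square distance from their centre is `m / 4` (`sum_powerset_norm_sq`), so that half of them lie in a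
ball of radius `√(m / 2)`, and comparing volumes gives `4 ^ m ≤ 4 * (9 * m) ^ n`
(`four_pow_le_of_not_selectivelyBalancing`), that is, `m ≤ (1 / 2 + o(1)) * n * log₂ n`.

For the lower bound, fix `L` and take `n * L` vectors of squared norm `T = 4 ^ L`, indexed by
`j < n` and `l < L` (`notMem_balancingNumbers`). The vector with index `(j, l)` has three parts.
The first is `2 ^ l • e_j` in `ℝⁿ`; the second is a multiple, of squared norm `3 T / 4`, of a vector
of signs; the third is one coordinate, which makes up the rest of the squared norm. Let `x ≠ 0` have
entries in `{-1, 0, 1}`.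
* If `x` involves at least `T` different `j`, the first part of the combination is an integer vector
  with at least `T` nonzero entries, since `∑ l, x (j, l) * 2 ^ l` vanishes only if all `x (j, l)`
  do. Hence its squared norm is at least `T`.
* Otherwise `x` has at most `T * L` nonzero entries, and the second part alone suffices once there
  are two of them: there are `15 * k` sign coordinates, with `k` of order `T * L * log (n * L)`, for
  which every such combination of sign vectors has squared norm at least `4 / 3` times that of a
  single one (`exists_sign_matrix`).
* If `x` has only one nonzero entry, the squared norm is `T`.

With `L = ⌊c * log₂ d⌋` and `c < 1 / 2`, the number `T = 4 ^ L` is smaller than the dimension `d` by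
a power of `d`, so that the sign coordinates cost only `o(d)` dimensions, and almost `c * d * log₂ d`
vectors remain.
-/

/-! ### The packing upper bound -/

/-- The second moment of the subset sums of `u` about their centre, with a shift `w` that makes the
induction go through. -/
theorem sum_powerset_norm_sq {E ι : Type*} [NormedAddCommGroup E] [InnerProductSpace ℝ E]
    [DecidableEq ι] (u : ι → E) (S : Finset ι) (w : E) :
    ∑ A ∈ S.powerset, ‖w + ∑ i ∈ A, u i - (1 / 2 : ℝ) • ∑ i ∈ S, u i‖ ^ 2 =
      2 ^ S.card * (‖w‖ ^ 2 + (1 / 4) * ∑ i ∈ S, ‖u i‖ ^ 2) := by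
  induction S using Finset.induction_on generalizing w with
  | empty => simp
  | insert a S ha ih =>
    rw [Finset.sum_powerset_insert ha]
    have h1 : ∀ A ∈ S.powerset,
        ‖w + ∑ i ∈ A, u i - (1 / 2 : ℝ) • ∑ i ∈ insert a S, u i‖ ^ 2 =
        ‖(w - (1 / 2 : ℝ) • u a) + ∑ i ∈ A, u i - (1 / 2 : ℝ) • ∑ i ∈ S, u i‖ ^ 2 := by
      intro A _
      rw [Finset.sum_insert ha]
      congr 2
      module
    have h2 : ∀ A ∈ S.powerset,
        ‖w + ∑ i ∈ insert a A, u i - (1 / 2 : ℝ) • ∑ i ∈ insert a S, u i‖ ^ 2 =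
        ‖(w + (1 / 2 : ℝ) • u a) + ∑ i ∈ A, u i - (1 / 2 : ℝ) • ∑ i ∈ S, u i‖ ^ 2 := by
      intro A hA
      rw [Finset.sum_insert ha,
        Finset.sum_insert (fun h => ha (Finset.mem_powerset.1 hA h))]
      congr 2
      module
    rw [Finset.sum_congr rfl h1, Finset.sum_congr rfl h2, ih, ih, Finset.card_insert_of_notMem ha,
      Finset.sum_insert ha, @norm_sub_sq_real, @norm_add_sq_real, norm_smul, pow_succ]
    norm_num
    ring

/-- The balls of radius `1 / 2` about the points are disjoint and lie in the ball of radius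
`ρ + 1 / 2` about the origin. -/
theorem card_le_of_one_separated {E ι : Type*} [NormedAddCommGroup E] [NormedSpace ℝ E]
    [FiniteDimensional ℝ E] (F : Finset ι) (c : ι → E) {ρ : ℝ} (hρ : 0 ≤ ρ)
    (hc : ∀ i ∈ F, ‖c i‖ ≤ ρ) (hsep : ∀ i ∈ F, ∀ j ∈ F, i ≠ j → 1 ≤ ‖c i - c j‖) :
    (F.card : ℝ) ≤ (2 * ρ + 1) ^ Module.finrank ℝ E := by
  borelize E
  let μ : MeasureTheory.Measure E := MeasureTheory.Measure.addHaar
  obtain ⟨δ, hδ⟩ : ∃ δ : ℝ, δ = 1 / 2 := ⟨_, rfl⟩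
  have hd : (F : Set ι).PairwiseDisjoint (fun i => Metric.ball (c i) δ) := by
    intro i hi j hj hij
    apply Metric.ball_disjoint_ball
    rw [dist_eq_norm]
    have := hsep i hi j hj hij
    linarith [hδ]
  have hsub : (⋃ i ∈ F, Metric.ball (c i) δ) ⊆ Metric.ball (0 : E) (ρ + δ) := by
    refine Set.iUnion₂_subset fun i hi => ?_
    apply Metric.ball_subset_ball'
    rw [dist_zero_right]
    linarith [hc i hi]
  have I : (F.card : ENNReal) * ENNReal.ofReal (δ ^ Module.finrank ℝ E) * μ (Metric.ball 0 1) ≤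
      ENNReal.ofReal ((ρ + δ) ^ Module.finrank ℝ E) * μ (Metric.ball 0 1) :=
    calc (F.card : ENNReal) * ENNReal.ofReal (δ ^ Module.finrank ℝ E) * μ (Metric.ball 0 1)
        = μ (⋃ i ∈ F, Metric.ball (c i) δ) := by
          rw [MeasureTheory.measure_biUnion_finset hd (fun i _ => measurableSet_ball)]
          have hδ0 : 0 < δ := by norm_num [hδ]
          simp only [μ.addHaar_ball_of_pos _ hδ0, Finset.sum_const, nsmul_eq_mul, mul_assoc]
      _ ≤ μ (Metric.ball (0 : E) (ρ + δ)) := MeasureTheory.measure_mono hsub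
      _ = _ := by rw [μ.addHaar_ball_of_pos _ (by norm_num [hδ]; linarith)]
  have J : (F.card : ENNReal) * ENNReal.ofReal (δ ^ Module.finrank ℝ E) ≤
      ENNReal.ofReal ((ρ + δ) ^ Module.finrank ℝ E) :=
    (ENNReal.mul_le_mul_iff_left (Metric.measure_ball_pos μ _ zero_lt_one).ne'
      Metric.isBounded_ball.measure_lt_top.ne).1 I
  have K : (F.card : ℝ) * δ ^ Module.finrank ℝ E ≤ (ρ + δ) ^ Module.finrank ℝ E := by
    have := ENNReal.toReal_le_of_le_ofReal (pow_nonneg (by norm_num [hδ]; linarith) _) J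
    simpa [ENNReal.toReal_mul, ENNReal.toReal_ofReal, hδ] using this
  have h2 : (2 * ρ + 1) ^ Module.finrank ℝ E * δ ^ Module.finrank ℝ E =
      (ρ + δ) ^ Module.finrank ℝ E := by
    rw [← mul_pow]; congr 1; rw [hδ]; ring
  rw [← h2] at K
  exact le_of_mul_le_mul_right K (by positivity)

/-- Packing bound: the subset sums of a family that is not selectively balancing are `1`-separated,
and half of them lie in a ball of radius `√(m / 2)`. -/
theorem four_pow_le_of_not_selectivelyBalancing {n m : ℕ} (hm : 0 < m)
    (u : Fin m → EuclideanSpace ℝ (Fin n)) (hu : ∀ i, ‖u i‖ = 1) (h : ¬ SelectivelyBalancing u) :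
    (4 : ℝ) ^ m ≤ 4 * (9 * m) ^ n := by
  have hm1 : (1 : ℝ) ≤ m := by exact_mod_cast hm
  let c : Finset (Fin m) → EuclideanSpace ℝ (Fin n) :=
    fun A => 0 + ∑ i ∈ A, u i - (1 / 2 : ℝ) • ∑ i, u i
  have hsum : ∑ A : Finset (Fin m), ‖c A‖ ^ 2 = 2 ^ m * (m / 4) := by
    have := sum_powerset_norm_sq u Finset.univ 0
    simp only [hu] at this
    rw [Finset.powerset_univ] at this
    rw [this]
    simp
    ring
  -- A difference of two subset sums is a combination with coefficients in `{-1, 0, 1}`.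
  have hsep : ∀ A B : Finset (Fin m), A ≠ B → 1 ≤ ‖c A - c B‖ := by
    intro A B hAB
    by_contra hlt
    refine h ⟨fun i => (if i ∈ A then 1 else 0) - (if i ∈ B then 1 else 0), ?_, ?_, ?_⟩
    · intro i
      by_cases hA : i ∈ A <;> by_cases hB : i ∈ B <;> simp [hA, hB]
    · by_contra hall
      push Not at hall
      apply hAB
      ext i
      have := hall i
      by_cases hA : i ∈ A <;> by_cases hB : i ∈ B <;> simp_all
    · push Not at hlt
      refine lt_of_eq_of_lt (congrArg norm ?_) hlt
      simp [c, sub_smul, Finset.sum_sub_distrib, ite_smul]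
  let F : Finset (Finset (Fin m)) := {A | ‖c A‖ ^ 2 ≤ m / 2}
  have hhalf : (2 : ℝ) ^ m ≤ 2 * F.card := by
    -- Markov's inequality: the mean of `‖c A‖ ^ 2` is half of the threshold `m / 2`.
    have h1 : (Fᶜ.card : ℝ) * (m / 2) ≤ 2 ^ m * (m / 4) := by
      rw [← hsum, ← nsmul_eq_mul, ← Finset.sum_const]
      calc ∑ A ∈ Fᶜ, (m / 2 : ℝ) ≤ ∑ A ∈ Fᶜ, ‖c A‖ ^ 2 := by
            refine Finset.sum_le_sum fun A hA => ?_
            simp only [F, Finset.mem_compl, Finset.mem_filter, Finset.mem_univ, true_and,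
              not_le] at hA
            exact hA.le
        _ ≤ _ := Finset.sum_le_univ_sum_of_nonneg fun A => by positivity
    have h2 : (F.card : ℝ) + Fᶜ.card = 2 ^ m := by
      have := Finset.card_add_card_compl F
      simp only [Fintype.card_finset, Fintype.card_fin] at this
      exact_mod_cast this
    nlinarith
  have hvol := card_le_of_one_separated F c (ρ := √(m / 2)) (by positivity)
    (fun A hA => by
      exact Real.le_sqrt_of_sq_le (by simpa [F] using hA))
    (fun A _ B _ hAB => hsep A B hAB)
  rw [finrank_euclideanSpace_fin] at hvol
  have h3 : (2 * √(m / 2 : ℝ) + 1) ^ 2 ≤ 9 * m := by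
    have hs := Real.sq_sqrt (show (0 : ℝ) ≤ m / 2 by positivity)
    nlinarith [sq_nonneg (√(m / 2 : ℝ) - 1), Real.sqrt_nonneg (m / 2 : ℝ)]
  calc (4 : ℝ) ^ m = (2 ^ m) ^ 2 := by rw [← pow_mul, mul_comm, pow_mul]; norm_num
    _ ≤ (2 * (2 * √(m / 2 : ℝ) + 1) ^ n) ^ 2 := by gcongr; linarith
    _ = 4 * ((2 * √(m / 2 : ℝ) + 1) ^ 2) ^ n := by
        rw [mul_pow, ← pow_mul, ← pow_mul, mul_comm n]; norm_num
    _ ≤ 4 * (9 * m) ^ n := by gcongr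

theorem mem_balancingNumbers_of_lt {n m : ℕ} (hm : 0 < m) (h : (4 : ℝ) * (9 * m) ^ n < 4 ^ m) :
    m ∈ balancingNumbers n := by
  intro u hu
  by_contra hb
  exact h.not_ge (four_pow_le_of_not_selectivelyBalancing hm u hu hb)

theorem balancingNumbers_nonempty (n : ℕ) : (balancingNumbers n).Nonempty := by
  have h := (tendsto_pow_const_div_const_pow_of_one_lt n (r := (4 : ℝ)) (by norm_num)).const_mul
    ((4 : ℝ) * 9 ^ n)
  rw [mul_zero] at h
  obtain ⟨m, hm, hm0⟩ := ((h.eventually_lt_const one_pos).and (eventually_gt_atTop 0)).exists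
  refine ⟨m, mem_balancingNumbers_of_lt hm0 ?_⟩
  rw [← mul_div_assoc, div_lt_one (by positivity)] at hm
  rwa [mul_pow, ← mul_assoc]

theorem balancingNumbers_upward {n m k : ℕ} (h : m ∈ balancingNumbers n) (hmk : m ≤ k) :
    k ∈ balancingNumbers n := by
  intro u hu
  obtain ⟨ε, hε, ⟨i, hi⟩, hlt⟩ := h (fun i => u (Fin.castLE hmk i)) (fun i => hu _)
  have hinj := Fin.castLE_injective hmk
  refine ⟨Function.extend (Fin.castLE hmk) ε 0, fun j => ?_,
    ⟨Fin.castLE hmk i, by rwa [hinj.extend_apply]⟩, ?_⟩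
  · by_cases hj : ∃ a, Fin.castLE hmk a = j
    · obtain ⟨a, rfl⟩ := hj
      rw [hinj.extend_apply]
      exact hε a
    · rw [Function.extend_apply' _ _ _ hj]
      simp
  · convert hlt using 2
    symm
    refine Finset.sum_of_injOn (Fin.castLE hmk) hinj.injOn (by simp) (fun j _ hj => ?_)
      (fun a _ => by rw [hinj.extend_apply])
    rw [Function.extend_apply' _ _ _ (by rwa [Finset.coe_univ, Set.image_univ] at hj)]
    simp

theorem isLeast_sigmaBal (n : ℕ) : IsLeast (balancingNumbers n) (sigmaBal n) :=
  ⟨Nat.sInf_mem (balancingNumbers_nonempty n), fun _ h => Nat.sInf_le h⟩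

theorem lt_sigmaBal {n m : ℕ} (h : m ∉ balancingNumbers n) : m < sigmaBal n := by
  by_contra hle
  exact h (balancingNumbers_upward (isLeast_sigmaBal n).1 (not_lt.1 hle))

/-! ### Random signs and sparse vectors -/

/-- The weight `t ↦ b ^ (t ^ 2)` averages to at most `3 / 4` over the four values `s + 2`, `s`, `s`,
`s - 2`, which a sum of signs takes when two of the signs vary. -/
theorem pow_natAbs_sq_shift_le {b : ℝ} (hb0 : 0 ≤ b) (hb : b ^ 4 = 1 / 2) (s : ℤ) :
    b ^ ((s + 2).natAbs ^ 2) + 2 * b ^ (s.natAbs ^ 2) + b ^ ((s - 2).natAbs ^ 2) ≤ 3 := by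
  have hb1 : b ≤ 12 / 13 := by
    by_contra h
    have := pow_lt_pow_left₀ (not_le.1 h) (by norm_num) (n := 4) (by norm_num)
    norm_num [hb] at this
  have hle : b ≤ 1 := by linarith
  have hone : ∀ t : ℤ, b ^ (t.natAbs ^ 2) ≤ 1 := fun t => pow_le_one₀ hb0 hle
  have hhalf : ∀ t : ℤ, 2 ≤ t.natAbs → b ^ (t.natAbs ^ 2) ≤ 1 / 2 := by
    intro t ht
    rw [← hb]
    exact pow_le_pow_of_le_one hb0 hle (by nlinarith)
  -- Equality holds at `s = 0`; the case `|s| = 1` uses `3 * b + b ^ 9 = 13 / 4 * b ≤ 3`.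
  have h9 : b ^ 9 = b / 4 := by
    rw [show b ^ 9 = b ^ 4 * b ^ 4 * b by ring, hb]; ring
  rcases lt_trichotomy s 0 with h | rfl | h
  · rcases eq_or_ne s (-1) with rfl | h1
    · norm_num [h9]; linarith
    · linarith [hone (s + 2), hhalf s (by omega), hhalf (s - 2) (by omega)]
  · norm_num [hb]
  · rcases eq_or_ne s 1 with rfl | h1
    · norm_num [h9]; linarith
    · linarith [hone (s - 2), hhalf s (by omega), hhalf (s + 2) (by omega)]

/-- If `x` has entries `±1` at two places `i ≠ j`, then the weight
`b ^ (⟨r, x⟩ ^ 2)` has mean at most `3 / 4` over uniform sign vectors `r`. -/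
theorem sum_signs_pow_le {ι : Type*} [Fintype ι] [DecidableEq ι] {b : ℝ} (hb0 : 0 ≤ b)
    (hb : b ^ 4 = 1 / 2) (x : ι → ℤ) {i j : ι} (hij : i ≠ j) (hi : x i = 1 ∨ x i = -1)
    (hj : x j = 1 ∨ x j = -1) :
    ∑ r : ι → ℤˣ, b ^ ((∑ l, (r l : ℤ) * x l).natAbs ^ 2) ≤ 3 / 4 * 2 ^ Fintype.card ι := by
  set S : (ι → ℤˣ) → ℤ := fun r => ∑ l, (r l : ℤ) * x l with hS
  -- Multiplication by `fl a` flips the sign at `a`; averaging over the flips at `i` and `j` reduces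
  -- the claim to `pow_natAbs_sq_shift_le`.
  let fl : ι → ι → ℤˣ := fun a => Function.update 1 a (-1)
  have hflip : ∀ a r, S (fl a * r) = S r - 2 * ((r a : ℤ) * x a) := by
    intro a r
    simp only [hS]
    rw [← Finset.add_sum_erase _ _ (Finset.mem_univ a),
      ← Finset.add_sum_erase Finset.univ (fun l => (r l : ℤ) * x l) (Finset.mem_univ a)]
    have : ∀ l ∈ Finset.univ.erase a, (((fl a * r) l : ℤˣ) : ℤ) * x l = (r l : ℤ) * x l := by
      intro l hl
      simp [fl, Finset.ne_of_mem_erase hl]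
    rw [Finset.sum_congr rfl this]
    simp [fl]
    ring
  have hshift : ∀ g : ι → ℤˣ, ∑ r, b ^ ((S (g * r)).natAbs ^ 2) = ∑ r, b ^ ((S r).natAbs ^ 2) :=
    fun g => Equiv.sum_comp (Equiv.mulLeft g) (fun r => b ^ ((S r).natAbs ^ 2))
  have hpt : ∀ r, b ^ ((S r).natAbs ^ 2) + b ^ ((S (fl i * r)).natAbs ^ 2) +
      b ^ ((S (fl j * r)).natAbs ^ 2) + b ^ ((S (fl j * fl i * r)).natAbs ^ 2) ≤ 3 := by
    intro r
    have e : S (fl j * fl i * r) = S r - 2 * ((r i : ℤ) * x i) - 2 * ((r j : ℤ) * x j) := by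
      rw [mul_assoc, hflip, hflip]
      simp [fl, hij.symm]
    rw [e, hflip, hflip]
    have key : ∀ y : ℤ, y = 1 ∨ y = -1 → ∀ q : ℤˣ, (q : ℤ) * y = 1 ∨ (q : ℤ) * y = -1 := by
      rintro y hy q
      rcases Int.units_eq_one_or q with rfl | rfl <;> rcases hy with rfl | rfl <;> simp
    generalize S r = t
    have h0 := pow_natAbs_sq_shift_le hb0 hb t
    have h1 := pow_natAbs_sq_shift_le hb0 hb (t - 2)
    have h2 := pow_natAbs_sq_shift_le hb0 hb (t + 2)
    rw [sub_add_cancel] at h1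
    rw [add_sub_cancel_right] at h2
    rcases key _ hi (r i) with h | h <;> rcases key _ hj (r j) with h' | h' <;> rw [h, h'] <;>
      norm_num [← sub_eq_add_neg] at h0 h1 h2 ⊢ <;> linarith
  have hsum := Finset.sum_le_sum (fun r (_ : r ∈ Finset.univ) => hpt r)
  simp only [Finset.sum_add_distrib, hshift] at hsum
  rw [Finset.sum_const, Finset.card_univ, Fintype.card_fun, Fintype.card_units_int] at hsum
  simp only [nsmul_eq_mul] at hsum
  push_cast at hsum
  linarith

/-- A count of `{-1, 0, 1}`-vectors with at most `s` nonzero entries. Giving `x` the weight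
`θ ^ (number of nonzero entries)`, all `{-1, 0, 1}`-vectors together weigh `(1 + 2 * θ) ^ N`, which
for `θ = 1 / (2 * N)` is at most `exp 1`. -/
theorem card_sparse_le {ι : Type*} [Fintype ι] [DecidableEq ι] [Nonempty ι] (s : ℕ)
    (X : Finset (ι → ℤ)) (hX : ∀ x ∈ X, ∀ i, x i ∈ ({-1, 0, 1} : Finset ℤ))
    (hs : ∀ x ∈ X, (Finset.univ.filter fun i => x i ≠ 0).card ≤ s) :
    (X.card : ℝ) ≤ 4 * (2 * Fintype.card ι) ^ s := by
  obtain ⟨N, hN⟩ : ∃ N : ℝ, N = Fintype.card ι := ⟨_, rfl⟩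
  rw [← hN]
  have hN1 : 1 ≤ N := by
    have : 0 < Fintype.card ι := Fintype.card_pos
    rw [hN]; exact_mod_cast this
  set θ : ℝ := 1 / (2 * N) with hθ
  have hθ0 : 0 < θ := by positivity
  have hθ1 : θ ≤ 1 := by rw [hθ, div_le_one (by positivity)]; linarith
  have hw : ∀ x ∈ X, θ ^ s ≤ ∏ i, (if x i ≠ 0 then θ else 1) := by
    intro x hx
    rw [Finset.prod_ite]
    simp only [Finset.prod_const, one_pow, mul_one]
    exact pow_le_pow_of_le_one hθ0.le hθ1 (hs x hx)
  have htot : (X.card : ℝ) * θ ^ s ≤ (1 + 2 * θ) ^ Fintype.card ι := by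
    rw [← nsmul_eq_mul, ← Finset.sum_const]
    calc ∑ x ∈ X, θ ^ s ≤ ∑ x ∈ X, ∏ i, (if x i ≠ 0 then θ else 1) := Finset.sum_le_sum hw
      _ ≤ ∑ x ∈ Fintype.piFinset (fun _ : ι => ({-1, 0, 1} : Finset ℤ)),
            ∏ i, (if x i ≠ 0 then θ else 1) := by
          refine Finset.sum_le_sum_of_subset_of_nonneg
            (fun x hx => Fintype.mem_piFinset.2 (hX x hx)) fun x _ _ => ?_
          exact Finset.prod_nonneg fun i _ => by split_ifs <;> positivity
      _ = (1 + 2 * θ) ^ Fintype.card ι := by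
          rw [← Finset.prod_univ_sum (fun _ : ι => ({-1, 0, 1} : Finset ℤ))
            (fun _ (t : ℤ) => if t ≠ 0 then θ else 1)]
          rw [Finset.prod_const, Finset.card_univ]
          congr 1
          norm_num [Finset.sum_insert]
          ring
  have hexp : (1 + 2 * θ) ^ Fintype.card ι ≤ 4 := by
    calc (1 + 2 * θ) ^ Fintype.card ι ≤ (Real.exp (2 * θ)) ^ Fintype.card ι := by
          gcongr; linarith [Real.add_one_le_exp (2 * θ)]
      _ = Real.exp 1 := by
          rw [← Real.exp_nat_mul]; congr 1; rw [hθ, ← hN]; field_simp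
      _ ≤ 4 := by linarith [Real.exp_one_lt_d9]
  have hθs : (2 * N) ^ s * θ ^ s = 1 := by
    rw [← mul_pow, hθ, mul_one_div_cancel (by positivity), one_pow]
  calc (X.card : ℝ) = (2 * N) ^ s * (X.card * θ ^ s) := by
        rw [mul_comm (X.card : ℝ), ← mul_assoc, hθs, one_mul]
    _ ≤ (2 * N) ^ s * 4 := by gcongr; exact htot.trans hexp
    _ = _ := by ring

/-- There are `15 * k` sign vectors such that every `{-1, 0, 1}`-vector `x` with between `2` and `s`
nonzero entries has mean square inner product at least `4 / 3` with them. A random choice works: with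
`b ^ 4 = 1 / 2`, the expectation of `b ^ (∑ c, ⟨R c, x⟩ ^ 2)` is at most `(3 / 4) ^ (15 * k)`, a union
bound over `x` costs a factor `2 ^ k`, and the product is less than `b ^ (20 * k)`. -/
theorem exists_sign_matrix {ι : Type*} [Fintype ι] [DecidableEq ι] [Nonempty ι] (s k : ℕ)
    (hk : 0 < k) (h : (4 : ℝ) * (2 * Fintype.card ι) ^ s ≤ 2 ^ k) :
    ∃ R : Fin (15 * k) → ι → ℤˣ, ∀ x : ι → ℤ, (∀ i, x i ∈ ({-1, 0, 1} : Set ℤ)) →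
      2 ≤ (Finset.univ.filter fun i => x i ≠ 0).card →
      (Finset.univ.filter fun i => x i ≠ 0).card ≤ s →
      (20 * k : ℤ) ≤ ∑ c, (∑ i, (R c i : ℤ) * x i) ^ 2 := by
  classical
  obtain ⟨b, hb0, hb⟩ : ∃ b : ℝ, 0 < b ∧ b ^ 4 = 1 / 2 := by
    refine ⟨√(√(1 / 2)), by positivity, ?_⟩
    rw [show 4 = 2 * 2 from rfl, pow_mul, Real.sq_sqrt (by positivity), Real.sq_sqrt (by norm_num)]
  have hb1 : b < 1 := by
    by_contra hb1
    have := one_le_pow₀ (not_lt.1 hb1) (n := 4)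
    norm_num [hb] at this
  let X : Finset (ι → ℤ) := (Fintype.piFinset (fun _ : ι => ({-1, 0, 1} : Finset ℤ))).filter
    fun x => 2 ≤ (Finset.univ.filter fun i => x i ≠ 0).card ∧
      (Finset.univ.filter fun i => x i ≠ 0).card ≤ s
  have hXmem : ∀ x, x ∈ X ↔ (∀ i, x i ∈ ({-1, 0, 1} : Finset ℤ)) ∧
      2 ≤ (Finset.univ.filter fun i => x i ≠ 0).card ∧
      (Finset.univ.filter fun i => x i ≠ 0).card ≤ s := by
    intro x; simp only [X, Finset.mem_filter, Fintype.mem_piFinset]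
  have hXcard : (X.card : ℝ) ≤ 2 ^ k :=
    (card_sparse_le s X (fun x hx => ((hXmem x).1 hx).1)
      (fun x hx => ((hXmem x).1 hx).2.2)).trans h
  have hx : ∀ x ∈ X, ∑ R : Fin (15 * k) → ι → ℤˣ,
      ∏ c, b ^ ((∑ i, (R c i : ℤ) * x i).natAbs ^ 2) ≤ (3 / 4 * 2 ^ Fintype.card ι) ^ (15 * k) := by
    intro x hx
    obtain ⟨hx1, hx2, -⟩ := (hXmem x).1 hx
    obtain ⟨i, hi, j, hj, hij⟩ := Finset.one_lt_card.1 hx2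
    have hpm : ∀ l, l ∈ (Finset.univ.filter fun i => x i ≠ 0) → x l = 1 ∨ x l = -1 := by
      intro l hl
      have h1 := hx1 l
      simp at h1 hl
      tauto
    have := Finset.prod_univ_sum (fun _ : Fin (15 * k) => (Finset.univ : Finset (ι → ℤˣ)))
      (fun _ r => b ^ ((∑ i, (r i : ℤ) * x i).natAbs ^ 2))
    rw [Fintype.piFinset_univ] at this
    rw [← this, Finset.prod_const, Finset.card_univ, Fintype.card_fin]
    gcongr
    exact sum_signs_pow_le hb0.le hb x hij (hpm i hi) (hpm j hj)
  -- After taking `k`-th roots this is `2 * (3 / 4) ^ 15 < (1 / 2) ^ 5`.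
  have hnum : (2 : ℝ) ^ k * (3 / 4) ^ (15 * k) < b ^ (20 * k) := by
    rw [show 20 * k = 4 * (5 * k) by ring, pow_mul b, hb, pow_mul, pow_mul, ← mul_pow]
    exact pow_lt_pow_left₀ (by norm_num) (by norm_num) hk.ne'
  have htotal : ∑ R : Fin (15 * k) → ι → ℤˣ, ∑ x ∈ X,
      ∏ c, b ^ ((∑ i, (R c i : ℤ) * x i).natAbs ^ 2) <
      ∑ R : Fin (15 * k) → ι → ℤˣ, b ^ (20 * k) := by
    rw [Finset.sum_comm]
    calc _ ≤ ∑ x ∈ X, ((3 / 4 * 2 ^ Fintype.card ι) ^ (15 * k) : ℝ) := Finset.sum_le_sum hx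
      _ = X.card * (3 / 4) ^ (15 * k) * (2 ^ Fintype.card ι) ^ (15 * k) := by
          rw [Finset.sum_const, nsmul_eq_mul, mul_pow]; ring
      _ ≤ 2 ^ k * (3 / 4) ^ (15 * k) * (2 ^ Fintype.card ι) ^ (15 * k) := by gcongr
      _ < b ^ (20 * k) * (2 ^ Fintype.card ι) ^ (15 * k) := by gcongr
      _ = _ := by simp [mul_comm]
  obtain ⟨R, -, hR⟩ := Finset.exists_lt_of_sum_lt htotal
  refine ⟨R, fun x hx1 hx2 hx3 => ?_⟩
  have hxX : x ∈ X := (hXmem x).2 ⟨fun i => by simpa using hx1 i, hx2, hx3⟩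
  have hlt := (Finset.single_le_sum (f := fun x : ι → ℤ =>
    ∏ c, b ^ ((∑ i, (R c i : ℤ) * x i).natAbs ^ 2))
    (fun y _ => Finset.prod_nonneg fun c _ => by positivity) hxX).trans_lt hR
  simp only [Finset.prod_pow_eq_pow_sum] at hlt
  have := (pow_lt_pow_iff_right_of_lt_one₀ hb0 hb1).1 hlt
  calc (20 * k : ℤ) ≤ ((∑ c, (∑ i, (R c i : ℤ) * x i).natAbs ^ 2 : ℕ) : ℤ) := by
        exact_mod_cast this.le
    _ = _ := by push_cast; simp

/-! ### A family that is not selectively balancing -/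

/-- A matrix whose rows have squared norm `T`, and whose nontrivial `{-1, 0, 1}`-combinations of rows
have squared norm at least `T`, yields after scaling a family that is not selectively balancing. -/
theorem notMem_balancingNumbers_of_matrix {ι κ : Type*} [Fintype ι] [Fintype κ] (A : ι → κ → ℝ)
    {T : ℝ} (hT : 0 < T) (hrow : ∀ i, ∑ k, A i k ^ 2 = T)
    (hcomb : ∀ x : ι → ℤ, (∀ i, x i ∈ ({-1, 0, 1} : Set ℤ)) → (∃ i, x i ≠ 0) →
      T ≤ ∑ k, (∑ i, (x i : ℝ) * A i k) ^ 2) :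
    Fintype.card ι ∉ balancingNumbers (Fintype.card κ) := by
  intro h
  let e := Fintype.equivFin ι
  let f := Fintype.equivFin κ
  have hsT : √T ^ 2 = T := Real.sq_sqrt hT.le
  obtain ⟨ε, hε, ⟨i, hi⟩, hlt⟩ :=
    h (fun a => WithLp.toLp 2 fun c => A (e.symm a) (f.symm c) / √T) (by
      intro a
      rw [EuclideanSpace.norm_eq, Real.sqrt_eq_one]
      simp only [Real.norm_eq_abs, sq_abs, div_pow, hsT]
      rw [← Finset.sum_div, Equiv.sum_comp f.symm (fun k => A (e.symm a) k ^ 2), hrow,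
        div_self hT.ne'])
  refine hlt.not_ge ?_
  rw [EuclideanSpace.norm_eq, Real.one_le_sqrt]
  have hc := hcomb (fun i => ε (e i)) (fun i => hε _) ⟨e.symm i, by simpa using hi⟩
  have hcoord : ∀ k : κ, ∑ i, (ε (e i) : ℝ) * A i k = ∑ a, (ε a : ℝ) * A (e.symm a) k := by
    intro k
    rw [← Equiv.sum_comp e]
    simp
  calc (1 : ℝ) = T / T := (div_self hT.ne').symm
    _ ≤ (∑ k, (∑ i, (ε (e i) : ℝ) * A i k) ^ 2) / T := by gcongr
    _ = ∑ k, ((∑ i, (ε (e i) : ℝ) * A i k) / √T) ^ 2 := by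
        rw [Finset.sum_div]
        exact Finset.sum_congr rfl fun k _ => by rw [div_pow, hsT]
    _ = _ := by
        rw [← Equiv.sum_comp f.symm]
        refine Finset.sum_congr rfl fun c _ => ?_
        rw [hcoord, Real.norm_eq_abs, sq_abs, Finset.sum_div]
        simp [mul_div_assoc]

theorem eq_zero_of_sum_mul_two_pow_eq_zero {L : ℕ} (y : Fin L → ℤ)
    (hy : ∀ l, y l ∈ ({-1, 0, 1} : Set ℤ)) (h : ∑ l, y l * 2 ^ (l : ℕ) = 0) : ∀ l, y l = 0 := by
  induction L with
  | zero => exact fun l => l.elim0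
  | succ L ih =>
    have hs : ∑ l : Fin L, y l.succ * 2 ^ ((l.succ : Fin (L + 1)) : ℕ) =
        2 * ∑ l : Fin L, y l.succ * 2 ^ (l : ℕ) := by
      rw [Finset.mul_sum]
      refine Finset.sum_congr rfl fun l _ => ?_
      rw [Fin.val_succ, pow_succ]
      ring
    rw [Fin.sum_univ_succ, hs, Fin.val_zero, pow_zero, mul_one] at h
    -- By parity `y 0` is even, hence zero.
    have h0 := hy 0
    simp only [Set.mem_insert_iff, Set.mem_singleton_iff] at h0
    have hz : y 0 = 0 := by omega
    have hr := ih (fun l => y l.succ) (fun l => hy _) (by omega)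
    exact Fin.cases hz hr

/-- The construction behind the lower bound: `n * L` vectors in dimension `n + (15 * k + 1)`, namely
`2 ^ l • e_j`, followed by `15 * k` scaled signs and one coordinate that equalises the norms. -/
theorem notMem_balancingNumbers {n L k : ℕ} (hn : 0 < n) (hL : 0 < L) (hk : 0 < k)
    (h : (4 : ℝ) * (2 * (n * L)) ^ (4 ^ L * L) ≤ 2 ^ k) :
    n * L ∉ balancingNumbers (n + (15 * k + 1)) := by
  have : NeZero n := ⟨hn.ne'⟩
  have : NeZero L := ⟨hL.ne'⟩
  have hk' : (0 : ℝ) < k := by exact_mod_cast hk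
  obtain ⟨R, hR⟩ := exists_sign_matrix (ι := Fin n × Fin L) (4 ^ L * L) k hk (by simpa using h)
  obtain ⟨T, hT⟩ : ∃ T : ℝ, T = 4 ^ L := ⟨_, rfl⟩
  have hT0 : 0 < T := by rw [hT]; positivity
  have hα : √(T / (20 * k)) ^ 2 = T / (20 * k) := Real.sq_sqrt (by positivity)
  have hpad : ∀ l : Fin L, √(T / 4 - 4 ^ (l : ℕ)) ^ 2 = T / 4 - 4 ^ (l : ℕ) := by
    intro l
    refine Real.sq_sqrt ?_
    have h1 : (4 : ℝ) ^ ((l : ℕ) + 1) ≤ 4 ^ L := pow_le_pow_right₀ (by norm_num) l.2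
    rw [pow_succ] at h1
    rw [hT]
    linarith
  let A : Fin n × Fin L → Fin n ⊕ (Fin (15 * k) ⊕ Unit) → ℝ := fun p =>
    Sum.elim (fun j => if j = p.1 then 2 ^ (p.2 : ℕ) else 0)
      (Sum.elim (fun c => √(T / (20 * k)) * ((R c p : ℤ) : ℝ)) fun _ => √(T / 4 - 4 ^ (p.2 : ℕ)))
  have hrow : ∀ p, ∑ c, A p c ^ 2 = T := by
    intro p
    have hu : ∀ c, (((R c p : ℤ) : ℝ)) ^ 2 = 1 := by
      intro c
      rcases Int.units_eq_one_or (R c p) with h | h <;> simp [h]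
    simp only [A, Fintype.sum_sum_type, Sum.elim_inl, Sum.elim_inr, mul_pow, hα, hpad, hu]
    simp only [ite_pow, ne_eq, OfNat.ofNat_ne_zero, not_false_eq_true, zero_pow,
      Finset.sum_ite_eq', Finset.mem_univ, if_true, Finset.sum_const, Finset.card_univ,
      Fintype.card_fin, nsmul_eq_mul, Finset.univ_unique, Finset.card_singleton]
    rw [← pow_mul, mul_comm (p.2 : ℕ), pow_mul]
    push_cast
    field_simp
    ring
  have hmain := notMem_balancingNumbers_of_matrix A hT0 hrow ?_
  · simpa using hmain
  intro x hx hne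
  have hxz : ∀ p, x p = 0 ∨ (x p) ^ 2 = 1 := by
    intro p
    have := hx p
    simp only [Set.mem_insert_iff, Set.mem_singleton_iff] at this
    rcases this with h | h | h <;> simp [h]
  let supp : Finset (Fin n × Fin L) := Finset.univ.filter fun p => x p ≠ 0
  have hpos : 0 < supp.card := by
    obtain ⟨p, hp⟩ := hne
    exact Finset.card_pos.2 ⟨p, by simpa [supp] using hp⟩
  -- A single nonzero entry: the combination is `±` one of the rows.
  rcases Nat.lt_or_ge supp.card 2 with h2 | h2
  · obtain ⟨p, hp⟩ := Finset.card_eq_one.1 (show supp.card = 1 by omega)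
    have hp1 : (x p : ℝ) ^ 2 = 1 := by
      have : p ∈ supp := by simp [hp]
      have := (hxz p).resolve_left (by simpa [supp] using this)
      exact_mod_cast this
    refine le_of_eq ?_
    rw [← hrow p]
    refine Finset.sum_congr rfl fun c _ => ?_
    rw [Finset.sum_eq_single p, mul_pow, hp1, one_mul]
    · intro q _ hq
      have : q ∉ supp := by simpa [hp] using hq
      have : x q = 0 := by simpa [supp] using this
      simp [this]
    · simp
  -- `J` is the set of coordinates of the first part that `x` involves.
  let J : Finset (Fin n) := supp.image Prod.fst
  rcases Nat.lt_or_ge J.card (4 ^ L) with hJ | hJ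
  · -- Few coordinates: `x` is sparse, and the sign coordinates suffice.
    have hs : supp.card ≤ 4 ^ L * L := by
      have hsub : supp ⊆ J ×ˢ (Finset.univ : Finset (Fin L)) := fun p hp =>
        Finset.mem_product.2 ⟨Finset.mem_image_of_mem _ hp, Finset.mem_univ _⟩
      refine (Finset.card_le_card hsub).trans ?_
      rw [Finset.card_product, Finset.card_univ, Fintype.card_fin]
      exact Nat.mul_le_mul_right _ hJ.le
    have h20 : (20 * k : ℝ) ≤ ∑ c, (∑ p, ((R c p : ℤ) : ℝ) * x p) ^ 2 := by
      exact_mod_cast hR x hx h2 hs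
    calc T = T / (20 * k) * (20 * k) := by field_simp
      _ ≤ T / (20 * k) * ∑ c, (∑ p, ((R c p : ℤ) : ℝ) * x p) ^ 2 := by gcongr
      _ = ∑ c, (∑ p, (x p : ℝ) * A p (Sum.inr (Sum.inl c))) ^ 2 := by
          rw [Finset.mul_sum, ← hα]
          refine Finset.sum_congr rfl fun c _ => ?_
          rw [← mul_pow, Finset.mul_sum]
          congr 1
          refine Finset.sum_congr rfl fun p _ => ?_
          simp only [A, Sum.elim_inl, Sum.elim_inr]
          ring
      _ ≤ _ := by
          rw [Fintype.sum_sum_type, Fintype.sum_sum_type]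
          have h1 := Finset.sum_nonneg (s := Finset.univ) fun (c : Fin n) _ =>
            sq_nonneg (∑ p, (x p : ℝ) * A p (Sum.inl c))
          have h3 := Finset.sum_nonneg (s := Finset.univ) fun (c : Unit) _ =>
            sq_nonneg (∑ p, (x p : ℝ) * A p (Sum.inr (Sum.inr c)))
          linarith
  · -- Many coordinates: each of them contributes the square of a nonzero integer.
    have hy : ∀ j ∈ J, (1 : ℝ) ≤ (∑ p, (x p : ℝ) * A p (Sum.inl j)) ^ 2 := by
      intro j hj
      have heq : ∑ p, (x p : ℝ) * A p (Sum.inl j) = ((∑ l, x (j, l) * 2 ^ (l : ℕ) : ℤ) : ℝ) := by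
        rw [Fintype.sum_prod_type, Finset.sum_eq_single j]
        · simp [A]
        · intro i _ hi
          simp [A, hi.symm]
        · simp
      rw [heq]
      have hnz : ∑ l, x (j, l) * 2 ^ (l : ℕ) ≠ 0 := by
        intro h0
        obtain ⟨p, hp, rfl⟩ := Finset.mem_image.1 hj
        have := eq_zero_of_sum_mul_two_pow_eq_zero (fun l => x (p.1, l)) (fun l => hx _) h0 p.2
        simp [supp] at hp
        exact hp this
      have : (1 : ℤ) ≤ (∑ l, x (j, l) * 2 ^ (l : ℕ)) ^ 2 := by
        have := sq_pos_of_ne_zero hnz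
        omega
      exact_mod_cast this
    calc T ≤ J.card := by rw [hT]; exact_mod_cast hJ
      _ = ∑ j ∈ J, (1 : ℝ) := by simp
      _ ≤ ∑ j ∈ J, (∑ p, (x p : ℝ) * A p (Sum.inl j)) ^ 2 := Finset.sum_le_sum hy
      _ ≤ ∑ j, (∑ p, (x p : ℝ) * A p (Sum.inl j)) ^ 2 :=
          Finset.sum_le_univ_sum_of_nonneg fun j => sq_nonneg _
      _ ≤ _ := by
          rw [Fintype.sum_sum_type (f := fun c => (∑ p, (x p : ℝ) * A p c) ^ 2)]
          exact le_add_of_nonneg_right (Finset.sum_nonneg fun c _ => sq_nonneg _)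

/-! ### Asymptotics -/

theorem tendsto_logb_two_natCast : Tendsto (fun n : ℕ => Real.logb 2 n) atTop atTop :=
  (Real.tendsto_logb_atTop one_lt_two).comp tendsto_natCast_atTop_atTop

theorem eventually_mul_logb_le_rpow (K : ℝ) (hK : 0 < K) {δ : ℝ} (hδ : 0 < δ) :
    ∀ᶠ n : ℕ in atTop, K * Real.logb 2 n ≤ (n : ℝ) ^ δ := by
  have h := (isLittleO_log_rpow_atTop hδ).bound
    (show 0 < Real.log 2 / K from div_pos (Real.log_pos one_lt_two) hK)
  filter_upwards [tendsto_natCast_atTop_atTop.eventually h] with n hn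
  have h0 : 0 < Real.log 2 := Real.log_pos one_lt_two
  rw [Real.norm_eq_abs, Real.norm_of_nonneg (Real.rpow_nonneg (Nat.cast_nonneg n) δ)] at hn
  have h1 := (le_abs_self _).trans hn
  rw [Real.logb, ← mul_div_assoc, div_le_iff₀ h0]
  rw [div_mul_eq_mul_div, le_div_iff₀ hK] at h1
  linarith

theorem eventually_sigmaBal_lt {c : ℝ} (hc : 1 / 2 < c) :
    ∀ᶠ n : ℕ in atTop, (sigmaBal n : ℝ) < c * n * Real.logb 2 n := by
  obtain ⟨δ, hδ, hcδ⟩ : ∃ δ : ℝ, 0 < δ ∧ c = 1 / 2 + 2 * δ :=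
    ⟨(c - 1 / 2) / 2, by linarith, by ring⟩
  have hc' : 0 < 1 / 2 + δ := by linarith
  filter_upwards [eventually_mul_logb_le_rpow (9 * (1 / 2 + δ) + 9) (by linarith) hδ,
    tendsto_logb_two_natCast.eventually_ge_atTop 1, eventually_ge_atTop 1,
    tendsto_natCast_atTop_atTop.eventually_gt_atTop (2 / δ)] with n h1 h2 h3 h4
  have hn1 : (1 : ℝ) ≤ n := by exact_mod_cast h3
  obtain ⟨ℓ, hℓ⟩ : ∃ ℓ, ℓ = Real.logb 2 n := ⟨_, rfl⟩
  rw [← hℓ] at h1 h2 ⊢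
  have hnℓ : (n : ℝ) = 2 ^ ℓ := by
    rw [hℓ, Real.rpow_logb two_pos (by norm_num) (by linarith)]
  have hδn : 2 < δ * n := by rwa [div_lt_iff₀ hδ, mul_comm] at h4
  have hδnℓ : 2 < δ * n * ℓ := by nlinarith
  have hnℓ1 : 1 ≤ n * ℓ := by nlinarith
  have hm1 := Nat.le_ceil ((1 / 2 + δ) * n * ℓ)
  have hm2 := Nat.ceil_lt_add_one (show 0 ≤ (1 / 2 + δ) * n * ℓ by positivity)
  set m := ⌈(1 / 2 + δ) * n * ℓ⌉₊ with hm
  have hmpos : 0 < m := Nat.ceil_pos.2 (by positivity)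
  -- `m` exceeds `n` by a logarithmic factor only, so that `9 * m ≤ n ^ (1 + δ)`.
  have h9 : (9 * m : ℝ) ≤ 2 ^ (ℓ * (1 + δ)) := by
    calc (9 * m : ℝ) ≤ n * ((9 * (1 / 2 + δ) + 9) * ℓ) := by nlinarith
      _ ≤ n * (n : ℝ) ^ δ := by gcongr
      _ = 2 ^ (ℓ * (1 + δ)) := by
        rw [hnℓ, ← Real.rpow_mul two_pos.le, ← Real.rpow_add two_pos]
        congr 1; ring
  have hmem : m ∈ balancingNumbers n := by
    refine mem_balancingNumbers_of_lt hmpos ?_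
    calc (4 : ℝ) * (9 * m) ^ n ≤ 4 * (2 ^ (ℓ * (1 + δ))) ^ n := by gcongr
      _ = (2 : ℝ) ^ (2 + ℓ * (1 + δ) * n) := by
        rw [Real.rpow_add two_pos, Real.rpow_mul_natCast two_pos.le]; norm_num
      _ < (2 : ℝ) ^ (2 * m : ℝ) := by
        refine Real.rpow_lt_rpow_of_exponent_lt one_lt_two ?_
        nlinarith
      _ = 4 ^ m := by rw [Real.rpow_mul_natCast two_pos.le]; norm_num
  have hle : (sigmaBal n : ℝ) ≤ m := by exact_mod_cast (isLeast_sigmaBal n).2 hmem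
  rw [hcδ]
  nlinarith

/-- The losses in `n ≈ (1 - η) * d` and `L ≈ (1 / 2 - η) * ℓ`, rounding included, leave `n * L` above
`(1 / 2 - 2 * η) * d * ℓ`. -/
theorem mul_mul_lt_of_floor_bounds {c η d ℓ n L : ℝ} (hη : 0 < η) (hη8 : η ≤ 1 / 8)
    (hc : c ≤ 1 / 2 - 2 * η) (hℓ : 32 ≤ ℓ) (hηℓ : 4 < η * ℓ) (hηd : 90 < η * d) (hd : 0 < d)
    (hn0 : 0 < n) (hn : d * (1 - η) - 1 ≤ n) (hL : (1 / 2 - η) * ℓ - 1 ≤ L) :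
    c * d * ℓ < n * L := by
  have hL0 : 0 ≤ (1 / 2 - η) * ℓ - 1 := by
    have : 3 / 8 * 32 ≤ (1 / 2 - η) * ℓ := mul_le_mul (by linarith) hℓ (by norm_num) (by linarith)
    linarith
  have hdℓ : 0 < d * ℓ := mul_pos hd (by linarith)
  have e1 : c * (d * ℓ) ≤ (1 / 2 - 2 * η) * (d * ℓ) := by gcongr
  have e2 : 4 * d < η * ℓ * d := by gcongr
  have e3 : 90 * ℓ < η * d * ℓ := by gcongr
  have e4 : 0 < η * η * (d * ℓ) := by positivity
  have e5 : 0 < η * ℓ := by linarith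
  have e6 : 0 < η * d := by linarith
  calc c * d * ℓ = c * (d * ℓ) := by ring
    _ < (d * (1 - η) - 1) * ((1 / 2 - η) * ℓ - 1) := by linarith
    _ ≤ n * L := mul_le_mul hn hL hL0 hn0.le

theorem eventually_lt_sigmaBal {c : ℝ} (hc : c < 1 / 2) :
    ∀ᶠ n : ℕ in atTop, c * n * Real.logb 2 n < sigmaBal n := by
  obtain ⟨η, hη, hη8, hcη⟩ : ∃ η : ℝ, 0 < η ∧ η ≤ 1 / 8 ∧ c ≤ 1 / 2 - 2 * η := by
    refine ⟨(1 / 2 - max c (1 / 4)) / 2, ?_, ?_, ?_⟩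
    · have := max_lt hc (show (1 / 4 : ℝ) < 1 / 2 by norm_num)
      linarith
    · linarith [le_max_right c (1 / 4)]
    · linarith [le_max_left c (1 / 4)]
  filter_upwards [eventually_mul_logb_le_rpow (60 / η) (by positivity) hη,
    eventually_mul_logb_le_rpow 1 one_pos one_pos,
    tendsto_logb_two_natCast.eventually_gt_atTop (4 / η),
    tendsto_natCast_atTop_atTop.eventually_gt_atTop (90 / η)] with d h1 h2 h3 h4
  obtain ⟨ℓ, hℓ⟩ : ∃ ℓ, ℓ = Real.logb 2 d := ⟨_, rfl⟩
  rw [← hℓ] at h1 h2 h3 ⊢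
  rw [Real.rpow_one, one_mul] at h2
  have hηd : 90 < η * d := by rwa [div_lt_iff₀ hη, mul_comm] at h4
  have hηℓ : 4 < η * ℓ := by rwa [div_lt_iff₀ hη, mul_comm] at h3
  have hℓ32 : 32 < ℓ := by nlinarith
  have hd1 : (720 : ℝ) < d := by nlinarith
  have hdℓ : (d : ℝ) = 2 ^ ℓ := by
    rw [hℓ, Real.rpow_logb two_pos (by norm_num) (by linarith)]
  -- `L` is the number of powers of two per coordinate; `15 * k` counts the sign coordinates.
  have hL1 := Nat.floor_le (show 0 ≤ (1 / 2 - η) * ℓ by nlinarith)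
  have hL2 := Nat.lt_floor_add_one ((1 / 2 - η) * ℓ)
  set L := ⌊(1 / 2 - η) * ℓ⌋₊ with hL
  have hk1 := Nat.floor_le (show 0 ≤ η * d / 15 by positivity)
  have hk2 := Nat.lt_floor_add_one (η * d / 15)
  set k := ⌊η * d / 15⌋₊ with hk
  have hLpos : 0 < L := Nat.floor_pos.2 (by nlinarith)
  have hkpos : 0 < k := Nat.floor_pos.2 (by linarith)
  have hkd : 15 * k + 1 < d := by
    have : (15 * k + 1 : ℝ) < d := by nlinarith
    exact_mod_cast this
  obtain ⟨n, hn⟩ : ∃ n, d = n + (15 * k + 1) := ⟨d - (15 * k + 1), by omega⟩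
  have hnR : (d : ℝ) = n + (15 * k + 1) := by rw [hn]; push_cast; ring
  have hnpos : 0 < n := by omega
  have hn0 : (0 : ℝ) < n := by exact_mod_cast hnpos
  have h4L : (4 : ℝ) ^ L ≤ 2 ^ ((1 - 2 * η) * ℓ) := by
    calc (4 : ℝ) ^ L = 2 ^ (2 * L : ℝ) := by rw [Real.rpow_mul_natCast two_pos.le]; norm_num
      _ ≤ _ := Real.rpow_le_rpow_of_exponent_le one_le_two (by linarith)
  have hbase : (2 * (n * L) : ℝ) ≤ 2 ^ (2 * ℓ) := by
    have hLl : 2 * (L : ℝ) ≤ d := by nlinarith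
    calc (2 * (n * L) : ℝ) = n * (2 * L) := by ring
      _ ≤ d * d := by gcongr; linarith
      _ = 2 ^ (2 * ℓ) := by rw [hdℓ, ← Real.rpow_add two_pos]; congr 1; ring
  -- `4 ^ L ≤ d ^ (1 - 2 * η)`, and the two logarithmic factors cost less than `d ^ (2 * η)`.
  have hsparse : (4 : ℝ) ^ L * L * (2 * ℓ) ≤ η * d / 60 := by
    have hK : ℓ ≤ η / 60 * 2 ^ (η * ℓ) := by
      rw [hdℓ, ← Real.rpow_mul two_pos.le, mul_comm ℓ] at h1
      rw [div_mul_eq_mul_div, div_le_iff₀ hη] at h1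
      linarith
    have hp := Real.rpow_pos_of_pos two_pos (η * ℓ)
    have hsq : ℓ * ℓ ≤ η / 60 * (2 : ℝ) ^ (2 * η * ℓ) := by
      calc ℓ * ℓ ≤ (η / 60 * 2 ^ (η * ℓ)) * (η / 60 * 2 ^ (η * ℓ)) :=
            mul_self_le_mul_self (by linarith) hK
        _ = (η / 60) ^ 2 * (2 : ℝ) ^ (2 * η * ℓ) := by
          rw [show 2 * η * ℓ = η * ℓ + η * ℓ by ring, Real.rpow_add two_pos]; ring
        _ ≤ _ := by gcongr; nlinarith
    calc (4 : ℝ) ^ L * L * (2 * ℓ) = 4 ^ L * (2 * L * ℓ) := by ring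
      _ ≤ 2 ^ ((1 - 2 * η) * ℓ) * (ℓ * ℓ) := by gcongr; nlinarith
      _ ≤ 2 ^ ((1 - 2 * η) * ℓ) * (η / 60 * (2 : ℝ) ^ (2 * η * ℓ)) := by gcongr
      _ = η / 60 * (2 ^ ((1 - 2 * η) * ℓ) * (2 : ℝ) ^ (2 * η * ℓ)) := by ring
      _ = η * d / 60 := by
        rw [← Real.rpow_add two_pos, hdℓ, show (1 - 2 * η) * ℓ + 2 * η * ℓ = ℓ by ring]; ring
  have hcond : (4 : ℝ) * (2 * (n * L)) ^ (4 ^ L * L) ≤ 2 ^ k := by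
    calc (4 : ℝ) * (2 * (n * L)) ^ (4 ^ L * L) ≤ 4 * (2 ^ (2 * ℓ)) ^ (4 ^ L * L) := by gcongr
      _ = (2 : ℝ) ^ (2 + 2 * ℓ * (4 ^ L * L : ℕ)) := by
        rw [Real.rpow_add two_pos, Real.rpow_mul_natCast two_pos.le]; norm_num
      _ ≤ (2 : ℝ) ^ (k : ℝ) := by
        refine Real.rpow_le_rpow_of_exponent_le one_le_two ?_
        push_cast
        linarith
      _ = 2 ^ k := Real.rpow_natCast _ _
  have hlt := lt_sigmaBal (notMem_balancingNumbers hnpos hLpos hkpos hcond)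
  rw [← hn] at hlt
  have hltR : (n : ℝ) * L < sigmaBal d := by exact_mod_cast hlt
  exact (mul_mul_lt_of_floor_bounds hη hη8 hcη hℓ32.le hηℓ hηd (by linarith) hn0 (by linarith)
    (by linarith)).trans hltR

theorem mainTheorem1 :
    (∀ n : ℕ, IsLeast (balancingNumbers n) (sigmaBal n)) ∧
    (fun n : ℕ => (sigmaBal n : ℝ)) ~[atTop]
      (fun n : ℕ => (1 / 2 : ℝ) * n * Real.logb 2 n) ∧
    (∀ c₁ c₂ : ℝ, 1 / 2 < c₁ → c₂ < 1 / 2 → ∀ᶠ n : ℕ in atTop,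
      (sigmaBal n : ℝ) < c₁ * n * Real.logb 2 n ∧
      c₂ * n * Real.logb 2 n < (sigmaBal n : ℝ)) := by
  refine ⟨isLeast_sigmaBal, ?_, fun c₁ c₂ h₁ h₂ =>
    (eventually_sigmaBal_lt h₁).and (eventually_lt_sigmaBal h₂)⟩
  have hpos : ∀ᶠ n : ℕ in atTop, 0 < (1 / 2 : ℝ) * n * Real.logb 2 n := by
    filter_upwards [tendsto_logb_two_natCast.eventually_gt_atTop 0, eventually_gt_atTop 0]
      with n h1 h2
    have : (0 : ℝ) < n := by exact_mod_cast h2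
    positivity
  rw [isEquivalent_iff_tendsto_one (hpos.mono fun n h => h.ne')]
  refine tendsto_order.2 ⟨fun a ha => ?_, fun a ha => ?_⟩
  · filter_upwards [hpos, eventually_lt_sigmaBal (show a / 2 < 1 / 2 by linarith)] with n h1 h2
    rw [Pi.div_apply, lt_div_iff₀ h1]
    linarith
  · filter_upwards [hpos, eventually_sigmaBal_lt (show 1 / 2 < a / 2 by linarith)] with n h1 h2
    rw [Pi.div_apply, div_lt_iff₀ h1]
    linarith
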